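/- Let $\mathcal X$ be any measurable space, $\mathcal Y=\{+1,-1\}$, and let $\mathcal D$ be a probability distribution on $\mathcal X\times\mathcal Y$ with $\mathcal X$-marginal $\mathcal D_{\mathcal X}$, $p=\Pr[y=+1]\in(0,1)$ and $\eta(x)=\Pr[y=+1\mid x]$. For measurable $f\colon\mathcal X\to\mathbb R$ let $$R(f)=E\Big[I[(y-y')(f(x)-f(x'))<0]+\tfrac12 I[f(x)=f(x')]\ \Big|\ y\neq y'\Big],$$ where $(x,y),(x',y')$ are drawn independently from $\mathcal D$ (so $R(f)$ is one minus the AUC of $f$), and for $\phi\colon\mathbb R\to[0,\infty)$ let $$R_\phi(f)=\frac1{2p(1-p)}E_{x,x'\sim\mathcal D_{\mathcal X}^2}\big[\eta(x)(1-\eta(x'))\,\phi(f(x)-f(x'))+\eta(x')(1-\eta(x))\,\phi(f(x')-f(x))\big]\in[0,\infty].$$ Let $R^*=\inf_f R(f)$ and $R_\phi^*=\inf_f R_\phi(f)$, the infima being over all measurable $f\colon\mathcal X\to\mathbb R$. The pairwise surrogate loss $\phi(f(x)-f(x'))$ is called consistent with AUC if for every sequence $(f_n)_{n\ge1}$ of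 measurable functions $\mathcal X\to\mathbb R$ and every distribution $\mathcal D$ on $\mathcal X\times\mathcal Y$ with $0<p<1$, $$R_\phi(f_n)\to R_\phi^*\quad\text{implies}\quad R(f_n)\to R^*.$$ Then the pairwise surrogate loss is consistent with AUC for each of the following functions $\phi$: 1. the exponential loss $\phi(t)=e^{-t}$; 2. the logistic loss $\phi(t)=\ln(1+e^{-t})$; 3. for every $\epsilon>0$, the distance-weighted loss $\phi(t)=\frac1t$ if $t\ge\epsilon$, and $\phi(t)=\frac1\epsilon\left(2-\frac t\epsilon\right)$ if $t<\epsilon$; 4. for every real $q>1$, the $q$-norm hinge loss $\phi(t)=(\max(0,1-t))^q$; 5. for every $\epsilon>0$, the general hinge loss $\phi(t)=1-t$ if $t\le1-\epsilon$, $\phi(t)=\frac{(t-1-\epsilon)^2}{4\epsilon}$ if $1-\epsilon<t<1+\epsilon$, and $\phi(t)=0$ if $t\ge1+\epsilon$. -/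

import Mathlib

open MeasureTheory ProbabilityTheory Filter Topology
open scoped ENNReal

namespace AUC

noncomputable section

variable {X : Type*} [MeasurableSpace X]

/-- The numerical value of a label: the label set `{+1, -1}` is modelled by `Bool`,
where `true` stands for `+1` and `false` for `-1`. -/
def labelVal (y : Bool) : ℝ := if y then 1 else -1

/-- `p = Pr[y = +1]`. -/
def posProb (D : Measure (X × Bool)) : ℝ := D.real {z | z.2 = true}

/-- The conditional probability `η(x) = Pr[y = +1 | x]`, through the regular conditional
distribution of the label given the instance. -/
def eta (D : Measure (X × Bool)) [IsProbabilityMeasure D] (x : X) : ℝ :=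
  (D.condKernel x).real {true}

open Classical in
/-- The ranking loss: `1` if the pair is ordered wrongly, `1/2` for a tie, `0` otherwise
(for labels `y ≠ y'`). -/
def rankingLoss (f : X → ℝ) (z z' : X × Bool) : ℝ :=
  (if (labelVal z.2 - labelVal z'.2) * (f z.1 - f z'.1) < 0 then 1 else 0)
    + 1 / 2 * (if f z.1 = f z'.1 then 1 else 0)

/-- The expected ranking risk `R(f) = E[ℓ(f, (x, y), (x', y')) | y ≠ y']`, for two independent
draws from `D`. It equals one minus the AUC of `f`. -/
def risk (D : Measure (X × Bool)) (f : X → ℝ) : ℝ :=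
  ∫ w, rankingLoss f w.1 w.2 ∂(cond (D.prod D) {w | w.1.2 ≠ w.2.2})

/-- The Bayes risk `R*`, the infimum over all measurable score functions. -/
def bayesRisk (D : Measure (X × Bool)) : ℝ :=
  ⨅ f : {f : X → ℝ // Measurable f}, risk D f.1

/-- The expected `φ`-risk of a nonnegative loss `φ`, with values in `[0, ∞]`:
the expectation is over two independent draws from the instance marginal `D.fst`. -/
def phiRisk (φ : ℝ → ℝ) (D : Measure (X × Bool)) [IsProbabilityMeasure D] (f : X → ℝ) : ℝ≥0∞ :=
  (ENNReal.ofReal (2 * posProb D * (1 - posProb D)))⁻¹ *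
    ∫⁻ w, ENNReal.ofReal
        (eta D w.1 * (1 - eta D w.2) * φ (f w.1 - f w.2)
          + eta D w.2 * (1 - eta D w.1) * φ (f w.2 - f w.1)) ∂(D.fst.prod D.fst)

/-- The optimal expected `φ`-risk, the infimum over all measurable score functions. -/
def optPhiRisk (φ : ℝ → ℝ) (D : Measure (X × Bool)) [IsProbabilityMeasure D] : ℝ≥0∞ :=
  ⨅ f : {f : X → ℝ // Measurable f}, phiRisk φ D f.1

variable (X) in
/-- The pairwise surrogate loss `φ(f(x) - f(x'))`, with `φ` nonnegative, is consistent with AUC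
on the instance space `X`. -/
def Consistent (φ : ℝ → ℝ) : Prop :=
  ∀ f : ℕ → X → ℝ, (∀ n, Measurable (f n)) →
    ∀ (D : Measure (X × Bool)) [IsProbabilityMeasure D], 0 < posProb D → posProb D < 1 →
      Tendsto (fun n => phiRisk φ D (f n)) atTop (𝓝 (optPhiRisk φ D)) →
        Tendsto (fun n => risk D (f n)) atTop (𝓝 (bayesRisk D))

/-- The exponential loss. -/
def expLoss (t : ℝ) : ℝ := Real.exp (-t)

/-- The logistic loss. -/
def logisticLoss (t : ℝ) : ℝ := Real.log (1 + Real.exp (-t))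

/-- The distance-weighted loss. -/
def distWeightedLoss (ε t : ℝ) : ℝ := if ε ≤ t then 1 / t else 1 / ε * (2 - t / ε)

/-- The `q`-norm hinge loss. -/
def qHingeLoss (q t : ℝ) : ℝ := (max 0 (1 - t)) ^ q

/-- The general hinge loss. -/
def generalHingeLoss (ε t : ℝ) : ℝ :=
  if t ≤ 1 - ε then 1 - t else if t < 1 + ε then (t - 1 - ε) ^ 2 / (4 * ε) else 0

end

end AUC

namespace AUC

/-! The argument is variational: it needs neither a minimizer of the surrogate risk nor a
description of the Bayes-optimal rankers. Write W(f) for the integral of `weighted η f φ`; by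
symmetry the surrogate risk is a fixed multiple of W. The gradient of W at f is the function
`variation`.

If f nearly minimizes W, this gradient is small in L¹: moving f by a small constant amount against
the sign of the gradient would otherwise lower W below its infimum (`integral_abs_variation_le`).
Conversely, suppose η(x) ≥ η(y) + c but f(x) ≤ f(y). Since g is antitone, the gradients v at x and y
must differ: v(y) - v(x) is at least c² g(0) times the measure of the points z that are misordered
with x (`slope_mul_measure_misordered_le`). Integrating over all misordered pairs bounds the square
of their measure by the L¹ norm of v (`sq_measure_misordered_le`). So for every c > 0 the measure of
the pairs misordered at gap c tends to 0.

Such pairs, together with an error c, control the excess ranking risk over any competitor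
(`risk_le_add`), which gives consistency for every `IsSurrogate` loss. Each of the five losses is
then checked to be one. The modulus is taken relative to 1 + φ because the slope of the exponential
loss, for instance, is not uniformly continuous; the error stays integrable when W is finite. -/

/-- A nonnegative loss `φ` with `-g` a subgradient of `φ`, where `g` is nonnegative, does not vanish
at `0`, and varies uniformly little on short intervals relative to `1 + φ`. -/
structure IsSurrogate (φ g : ℝ → ℝ) : Prop where
  nonneg : ∀ t, 0 ≤ φ t
  slope_nonneg : ∀ t, 0 ≤ g t
  slope_zero_pos : 0 < g 0
  subgradient : ∀ a b, φ a - g a * (b - a) ≤ φ b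
  modulus : ∀ δ > 0, ∃ τ > 0, ∀ t u, |u| ≤ τ → |g (t + u) - g t| ≤ δ * (1 + φ t)

/-! ### Elementary inequalities for surrogate losses. -/

namespace IsSurrogate

variable {φ g : ℝ → ℝ}

theorem slope_antitone (S : IsSurrogate φ g) : Antitone g := by
  intro a b hab
  rcases hab.eq_or_lt with rfl | hlt
  · rfl
  · have h1 := S.subgradient a b
    have h2 := S.subgradient b a
    nlinarith

theorem loss_antitone (S : IsSurrogate φ g) : Antitone φ := by
  intro a b hab
  have h1 := S.subgradient b a
  nlinarith [mul_nonneg (S.slope_nonneg b) (sub_nonneg.2 hab)]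

theorem taylor (S : IsSurrogate φ g) {δ : ℝ} (hδ : 0 < δ) :
    ∃ τ > 0, ∀ t u, |u| ≤ τ → φ (t + u) ≤ φ t - u * g t + δ * |u| * (1 + φ t) := by
  obtain ⟨τ, hτ, H⟩ := S.modulus δ hδ
  refine ⟨τ, hτ, fun t u hu => ?_⟩
  -- The subgradient at the far point bounds `φ (t + u)` from above with slope `g (t + u)`; the
  -- modulus replaces that slope by `g t`.
  have h1 := S.subgradient (t + u) t
  have h2 := mul_le_mul_of_nonneg_left (H t u hu) (abs_nonneg u)
  rw [← abs_mul] at h2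
  have h3 := neg_le_of_abs_le h2
  nlinarith

/-- A step of length τ to the right lowers φ by about τ g(t), and φ cannot become negative. This
makes the slope integrable whenever the loss is. -/
theorem exists_slope_le (S : IsSurrogate φ g) : ∃ C, 0 ≤ C ∧ ∀ t, g t ≤ C * (1 + φ t) := by
  obtain ⟨τ, hτ, H⟩ := S.taylor one_pos
  refine ⟨1 / τ + 1, by positivity, fun t => ?_⟩
  have h1 := H t τ (abs_of_pos hτ).le
  rw [abs_of_pos hτ] at h1
  have h2 := S.nonneg (t + τ)
  have h3 : τ * g t ≤ τ * ((1 / τ + 1) * (1 + φ t)) := by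
    have : τ * ((1 / τ + 1) * (1 + φ t)) = 1 + φ t + τ * (1 + φ t) := by field_simp
    rw [this]; nlinarith
  exact le_of_mul_le_mul_left h3 hτ

end IsSurrogate

/-! ### The first variation of the surrogate risk. -/

variable {X : Type*} [MeasurableSpace X]

/-- The function `ψ (f x - f x')` weighted by the chance `η x * (1 - η x')` that the first label is
positive and the second one negative. -/
def weighted (η f : X → ℝ) (ψ : ℝ → ℝ) (w : X × X) : ℝ :=
  η w.1 * (1 - η w.2) * ψ (f w.1 - f w.2)

/-- The first variation of the expected loss with slope `-g` at the score function `f`. -/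
noncomputable def variation (μ : Measure X) (η f : X → ℝ) (g : ℝ → ℝ) (x : X) : ℝ :=
  ∫ y, weighted η f g (y, x) ∂μ - ∫ y, weighted η f g (x, y) ∂μ

/-- Pairs with conditional probabilities at least `c` apart which `f` does not order correctly. -/
def misordered (η f : X → ℝ) (c : ℝ) : Set (X × X) :=
  {w | η w.2 + c ≤ η w.1 ∧ f w.1 ≤ f w.2}

section

variable {μ : Measure X} [IsProbabilityMeasure μ] {η f : X → ℝ} {φ g ψ : ℝ → ℝ}

theorem measurable_weighted (hη : Measurable η) (hf : Measurable f) (hψ : Measurable ψ) :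
    Measurable (weighted η f ψ) := by
  unfold weighted
  fun_prop

theorem measurableSet_misordered (hη : Measurable η) (hf : Measurable f) (c : ℝ) :
    MeasurableSet (misordered η f c) :=
  (measurableSet_le ((hη.comp measurable_snd).add_const c) (hη.comp measurable_fst)).inter
    (measurableSet_le (hf.comp measurable_fst) (hf.comp measurable_snd))

omit [MeasurableSpace X] in
theorem weight_nonneg (h0 : ∀ x, 0 ≤ η x) (h1 : ∀ x, η x ≤ 1) (x y : X) :
    0 ≤ η x * (1 - η y) := mul_nonneg (h0 x) (sub_nonneg.2 (h1 y))

omit [MeasurableSpace X] in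
theorem weight_le_one (h0 : ∀ x, 0 ≤ η x) (h1 : ∀ x, η x ≤ 1) (x y : X) :
    η x * (1 - η y) ≤ 1 :=
  mul_le_one₀ (h1 x) (sub_nonneg.2 (h1 y)) (by linarith [h0 y])

omit [MeasurableSpace X] in
theorem weighted_nonneg (h0 : ∀ x, 0 ≤ η x) (h1 : ∀ x, η x ≤ 1) (hψ : ∀ t, 0 ≤ ψ t) (w : X × X) :
    0 ≤ weighted η f ψ w := mul_nonneg (weight_nonneg h0 h1 _ _) (hψ _)

theorem integrable_weighted_slope (S : IsSurrogate φ g) (hη : Measurable η)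
    (h0 : ∀ x, 0 ≤ η x) (h1 : ∀ x, η x ≤ 1) (hf : Measurable f)
    (hW : Integrable (weighted η f φ) (μ.prod μ)) : Integrable (weighted η f g) (μ.prod μ) := by
  obtain ⟨C, hC, H⟩ := S.exists_slope_le
  refine Integrable.mono' (((integrable_const (1 : ℝ)).add hW).const_mul C)
    (measurable_weighted hη hf S.slope_antitone.measurable).aestronglyMeasurable
    (Eventually.of_forall fun w => ?_)
  rw [Real.norm_of_nonneg (weighted_nonneg h0 h1 S.slope_nonneg w)]
  have a0 := weight_nonneg h0 h1 w.1 w.2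
  have a1 := weight_le_one h0 h1 w.1 w.2
  have h2 := mul_le_mul_of_nonneg_left (H (f w.1 - f w.2)) a0
  simp only [weighted, Pi.add_apply]
  nlinarith [mul_le_mul_of_nonneg_left a1 hC]

theorem integrable_variation (hG : Integrable (weighted η f g) (μ.prod μ)) :
    Integrable (variation μ η f g) μ :=
  (hG.integral_prod_right).sub hG.integral_prod_left

/-- By Fubini, this identifies `variation` as the gradient: the derivative of the expected loss in
direction s is minus the left side. -/
theorem integral_mul_sub_weighted (hG : Integrable (weighted η f g) (μ.prod μ)) {s : X → ℝ}
    (hs : Measurable s) (hs1 : ∀ x, |s x| ≤ 1) :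
    ∫ w, (s w.1 - s w.2) * weighted η f g w ∂(μ.prod μ)
      = - ∫ x, s x * variation μ η f g x ∂μ := by
  have i1 : Integrable (fun w : X × X => s w.1 * weighted η f g w) (μ.prod μ) :=
    hG.bdd_mul (c := 1) (hs.comp measurable_fst).aestronglyMeasurable
      (Eventually.of_forall fun w => hs1 _)
  have i2 : Integrable (fun w : X × X => s w.2 * weighted η f g w) (μ.prod μ) :=
    hG.bdd_mul (c := 1) (hs.comp measurable_snd).aestronglyMeasurable
      (Eventually.of_forall fun w => hs1 _)
  have j1 : Integrable (fun x => s x * ∫ y, weighted η f g (x, y) ∂μ) μ :=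
    hG.integral_prod_left.bdd_mul (c := 1) (by fun_prop) (Eventually.of_forall fun w => hs1 _)
  have j2 : Integrable (fun x => s x * ∫ y, weighted η f g (y, x) ∂μ) μ :=
    hG.integral_prod_right.bdd_mul (c := 1) (by fun_prop) (Eventually.of_forall fun w => hs1 _)
  simp only [sub_mul, variation, mul_sub]
  rw [integral_sub i1 i2, integral_sub j2 j1, integral_prod _ i1, integral_prod_symm _ i2]
  simp only [integral_const_mul]
  ring

theorem integral_abs_variation_le (S : IsSurrogate φ g) (hη : Measurable η)
    (h0 : ∀ x, 0 ≤ η x) (h1 : ∀ x, η x ≤ 1) {δ : ℝ} (hδ : 0 < δ) :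
    ∃ τ > 0, ∀ (f : X → ℝ) (J : ℝ), Measurable f → Integrable (weighted η f φ) (μ.prod μ) →
      (∀ f', Measurable f' → Integrable (weighted η f' φ) (μ.prod μ) →
        J ≤ ∫ w, weighted η f' φ w ∂(μ.prod μ)) →
      ∫ x, |variation μ η f g x| ∂μ ≤ (∫ w, weighted η f φ w ∂(μ.prod μ) - J) / τ
        + δ * (1 + ∫ w, weighted η f φ w ∂(μ.prod μ)) := by
  obtain ⟨τ, hτ, T⟩ := S.taylor (half_pos hδ)
  -- Each score moves by τ/2, so a difference of scores moves by at most τ, the range of the Taylor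
  -- bound.
  refine ⟨τ / 2, half_pos hτ, fun f J hf hW hJ => ?_⟩
  have hG := integrable_weighted_slope S hη h0 h1 hf hW
  have hmG := measurable_weighted hη hf S.slope_antitone.measurable
  have hv : Measurable (variation μ η f g) := by
    refine Measurable.sub ?_ ?_
    · exact (StronglyMeasurable.integral_prod_left' (μ := μ) hmG.stronglyMeasurable).measurable
    · exact (StronglyMeasurable.integral_prod_right' (ν := μ) hmG.stronglyMeasurable).measurable
  -- Steepest descent direction in the sup norm: the linear gain is τ/2 times the L¹ norm of the
  -- variation.
  set s : X → ℝ := fun x => if 0 ≤ variation μ η f g x then -1 else 1 with hs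
  have hsm : Measurable s :=
    Measurable.ite (measurableSet_le measurable_const hv) measurable_const measurable_const
  have hs1 : ∀ x, |s x| ≤ 1 := by
    intro x; simp only [hs]; split_ifs <;> simp
  have hsv : ∀ x, s x * variation μ η f g x = -|variation μ η f g x| := by
    intro x; simp only [hs]; split_ifs with h
    · rw [abs_of_nonneg h]; ring
    · rw [abs_of_neg (not_le.1 h)]; ring
  have hf' : Measurable (fun x => f x + τ / 2 * s x) := by fun_prop
  have iB : Integrable (fun w : X × X => (s w.1 - s w.2) * weighted η f g w) (μ.prod μ) := by
    refine hG.bdd_mul (c := 2) (by fun_prop) (Eventually.of_forall fun w => ?_)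
    have := abs_sub (s w.1) (s w.2)
    have := hs1 w.1
    have := hs1 w.2
    rw [Real.norm_eq_abs]; linarith
  have iC : Integrable (fun w : X × X => δ * (τ / 2) * (1 + weighted η f φ w)) (μ.prod μ) :=
    ((integrable_const (1 : ℝ)).add hW).const_mul _
  have bound : ∀ w, weighted η (fun x => f x + τ / 2 * s x) φ w ≤
      weighted η f φ w - τ / 2 * ((s w.1 - s w.2) * weighted η f g w)
        + δ * (τ / 2) * (1 + weighted η f φ w) := by
    intro w
    have a0 := weight_nonneg h0 h1 w.1 w.2
    have a1 := weight_le_one h0 h1 w.1 w.2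
    have hu : |τ / 2 * (s w.1 - s w.2)| ≤ τ := by
      have := abs_sub (s w.1) (s w.2)
      have := hs1 w.1
      have := hs1 w.2
      rw [abs_mul, abs_of_pos (half_pos hτ)]
      nlinarith
    have hT := T (f w.1 - f w.2) _ hu
    have hp := S.nonneg (f w.1 - f w.2)
    have hT' : φ (f w.1 + τ / 2 * s w.1 - (f w.2 + τ / 2 * s w.2)) ≤
        φ (f w.1 - f w.2) - τ / 2 * (s w.1 - s w.2) * g (f w.1 - f w.2)
          + δ * (τ / 2) * (1 + φ (f w.1 - f w.2)) := by
      have e : f w.1 + τ / 2 * s w.1 - (f w.2 + τ / 2 * s w.2)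
        = f w.1 - f w.2 + τ / 2 * (s w.1 - s w.2) := by ring
      rw [e]
      have : δ / 2 * |τ / 2 * (s w.1 - s w.2)| * (1 + φ (f w.1 - f w.2))
          ≤ δ * (τ / 2) * (1 + φ (f w.1 - f w.2)) := by
        apply mul_le_mul_of_nonneg_right _ (by linarith)
        nlinarith
      linarith
    have h2 := mul_le_mul_of_nonneg_left hT' a0
    have h3 := mul_le_mul_of_nonneg_left a1 (by positivity : 0 ≤ δ * (τ / 2))
    simp only [weighted]
    linarith
  have iR := (hW.sub (iB.const_mul (τ / 2))).add iC
  have hW' : Integrable (weighted η (fun x => f x + τ / 2 * s x) φ) (μ.prod μ) := by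
    refine Integrable.mono' iR
      (measurable_weighted hη hf' S.loss_antitone.measurable).aestronglyMeasurable
      (Eventually.of_forall fun w => ?_)
    rw [Real.norm_of_nonneg (weighted_nonneg h0 h1 S.nonneg w)]
    exact bound w
  have key := (hJ _ hf' hW').trans (integral_mono hW' iR bound)
  rw [integral_add' (hW.sub (iB.const_mul _)) iC, integral_sub' hW (iB.const_mul _),
    integral_const_mul, integral_const_mul, integral_add (integrable_const _) hW,
    integral_mul_sub_weighted hG hsm hs1] at key
  simp only [hsv, integral_neg, neg_neg, integral_const, probReal_univ, smul_eq_mul,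
    one_mul] at key
  rw [← sub_le_iff_le_add, le_div_iff₀ (half_pos hτ)]
  linarith

/-! ### Misordered pairs are controlled by the first variation. -/

/-- Write v(t) = (1 - η(t)) B(t) - η(t) A(t), with A and B the integrals of (1 - η(z)) g(f(t) -
f(z)) and η(z) g(f(z) - f(t)). Since f(x) ≤ f(y), A(y) ≤ A(x) and B(x) ≤ B(y), so v(y) - v(x) ≥
(η(x) - η(y)) (A(x) + B(y)) ≥ c A(x). -/
theorem slope_mul_measure_misordered_le (S : IsSurrogate φ g) (hη : Measurable η)
    (h0 : ∀ x, 0 ≤ η x) (h1 : ∀ x, η x ≤ 1) (hf : Measurable f) {c : ℝ} (hc : 0 < c)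
    {x y : X} (hxy : (x, y) ∈ misordered η f c)
    (hx : Integrable (fun z => weighted η f g (x, z)) μ)
    (hy : Integrable (fun z => weighted η f g (z, y)) μ) :
    c ^ 2 * g 0 * μ.real (Prod.mk x ⁻¹' misordered η f c)
      ≤ |variation μ η f g x| + |variation μ η f g y| := by
  obtain ⟨hηxy, hfxy⟩ := hxy
  simp only at hηxy hfxy
  have hηx : 0 < η x := by linarith [h0 y]
  have hηy : 0 < 1 - η y := by linarith [h1 x]
  have gm := S.slope_antitone.measurable
  -- The gap c keeps `η x` and `1 - η y` positive, so these factors can be divided out.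
  have iAx : Integrable (fun z => (1 - η z) * g (f x - f z)) μ := by
    refine (hx.const_mul (η x)⁻¹).congr (Eventually.of_forall fun z => ?_)
    simp only [weighted]; field_simp
  have iBy : Integrable (fun z => η z * g (f z - f y)) μ := by
    refine (hy.const_mul (1 - η y)⁻¹).congr (Eventually.of_forall fun z => ?_)
    simp only [weighted]; field_simp
  have leA : ∀ z, (1 - η z) * g (f y - f z) ≤ (1 - η z) * g (f x - f z) := fun z =>
    mul_le_mul_of_nonneg_left (S.slope_antitone (by linarith)) (sub_nonneg.2 (h1 z))
  have leB : ∀ z, η z * g (f z - f x) ≤ η z * g (f z - f y) := fun z =>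
    mul_le_mul_of_nonneg_left (S.slope_antitone (by linarith)) (h0 z)
  have iAy : Integrable (fun z => (1 - η z) * g (f y - f z)) μ := by
    refine iAx.mono' (by fun_prop) (Eventually.of_forall fun z => ?_)
    rw [Real.norm_of_nonneg (mul_nonneg (sub_nonneg.2 (h1 z)) (S.slope_nonneg _))]
    exact leA z
  have iBx : Integrable (fun z => η z * g (f z - f x)) μ := by
    refine iBy.mono' (by fun_prop) (Eventually.of_forall fun z => ?_)
    rw [Real.norm_of_nonneg (mul_nonneg (h0 z) (S.slope_nonneg _))]
    exact leB z
  have hA := integral_mono iAy iAx leA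
  have hB := integral_mono iBx iBy leB
  have hB0 : 0 ≤ ∫ z, η z * g (f z - f y) ∂μ :=
    integral_nonneg fun z => mul_nonneg (h0 z) (S.slope_nonneg _)
  have vx : ∀ t, variation μ η f g t = (1 - η t) * ∫ z, η z * g (f z - f t) ∂μ
      - η t * ∫ z, (1 - η z) * g (f t - f z) ∂μ := by
    intro t
    simp only [variation, weighted, ← integral_const_mul]
    congr 1 <;> refine integral_congr_ae (Eventually.of_forall fun z => ?_) <;> simp only <;> ring
  have hms : MeasurableSet (Prod.mk x ⁻¹' misordered η f c) :=
    measurable_prodMk_left (measurableSet_misordered hη hf c)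
  -- If z is misordered with x, then `1 - η z` is at least c and `f x - f z ≤ 0`, so the integrand
  -- is at least `c * g 0`.
  have hlow : c * g 0 * μ.real (Prod.mk x ⁻¹' misordered η f c)
      ≤ ∫ z, (1 - η z) * g (f x - f z) ∂μ := by
    rw [mul_comm, ← smul_eq_mul, ← integral_indicator_const _ hms]
    refine integral_mono ((integrable_const _).indicator hms) iAx fun z => ?_
    by_cases hz : z ∈ Prod.mk x ⁻¹' misordered η f c
    · rw [Set.indicator_of_mem hz]
      obtain ⟨hz1, hz2⟩ := hz
      simp only at hz1 hz2
      exact mul_le_mul (by linarith [h1 x]) (S.slope_antitone (by linarith))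
        S.slope_zero_pos.le (sub_nonneg.2 (h1 z))
    · rw [Set.indicator_of_notMem hz]
      exact mul_nonneg (sub_nonneg.2 (h1 z)) (S.slope_nonneg _)
  have e1 := neg_abs_le (variation μ η f g x)
  have e2 := le_abs_self (variation μ η f g y)
  rw [vx] at e1 e2
  rw [vx, vx]
  set Ax := ∫ z, (1 - η z) * g (f x - f z) ∂μ
  set Ay := ∫ z, (1 - η z) * g (f y - f z) ∂μ
  set Bx := ∫ z, η z * g (f z - f x) ∂μ
  set By := ∫ z, η z * g (f z - f y) ∂μ
  have hAx : 0 ≤ Ax :=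
    integral_nonneg fun z => mul_nonneg (sub_nonneg.2 (h1 z)) (S.slope_nonneg _)
  have q1 : (1 - η x) * Bx ≤ (1 - η x) * By := mul_le_mul_of_nonneg_left hB (sub_nonneg.2 (h1 x))
  have q2 : η y * Ay ≤ η y * Ax := mul_le_mul_of_nonneg_left hA (h0 y)
  have q3 : c * Ax ≤ (η x - η y) * Ax := mul_le_mul_of_nonneg_right (by linarith) hAx
  have q4 : 0 ≤ (η x - η y) * By := mul_nonneg (by linarith) hB0
  have q5 := mul_le_mul_of_nonneg_left hlow hc.le
  linarith

/-- Integrate the pairwise bound over the misordered set N. With m(x) the measure of the slice of N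
at x, the left side becomes the integral of m², at least the square of the integral of m, which is
the measure of N. -/
theorem sq_measure_misordered_le (S : IsSurrogate φ g) (hη : Measurable η)
    (h0 : ∀ x, 0 ≤ η x) (h1 : ∀ x, η x ≤ 1) (hf : Measurable f)
    (hW : Integrable (weighted η f φ) (μ.prod μ)) {c : ℝ} (hc : 0 < c) :
    c ^ 2 * g 0 * (μ.prod μ).real (misordered η f c) ^ 2
      ≤ 2 * ∫ x, |variation μ η f g x| ∂μ := by
  have hG := integrable_weighted_slope S hη h0 h1 hf hW
  have hv := (integrable_variation hG).abs
  have hN := measurableSet_misordered hη hf c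
  set N := misordered η f c
  set m : X → ℝ := fun x => μ.real (Prod.mk x ⁻¹' N)
  have hmm : Measurable m := (measurable_measure_prodMk_left hN).ennreal_toReal
  have hm0 : ∀ x, 0 ≤ m x := fun x => measureReal_nonneg
  have hm1 : ∀ x, m x ≤ 1 := fun x => measureReal_le_one
  have im : Integrable m μ := Integrable.of_bound hmm.aestronglyMeasurable 1
    (Eventually.of_forall fun x => by rw [Real.norm_of_nonneg (hm0 x)]; exact hm1 x)
  have im2 : Integrable (fun x => m x ^ 2) μ :=
    Integrable.of_bound (by fun_prop) 1 (Eventually.of_forall fun x => by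
      rw [Real.norm_of_nonneg (sq_nonneg _)]; exact pow_le_one₀ (hm0 x) (hm1 x))
  have iN : Integrable (N.indicator fun _ => (1 : ℝ)) (μ.prod μ) :=
    (integrable_const _).indicator hN
  have fib : ∀ x, ∫ y, N.indicator (fun _ => (1 : ℝ)) (x, y) ∂μ = m x := fun x =>
    (integral_indicator_one (measurable_prodMk_left hN))
  have hM : ∫ x, m x ∂μ = (μ.prod μ).real N := by
    rw [← integral_indicator_one hN]
    exact ((integral_prod _ iN).trans (integral_congr_ae (Eventually.of_forall fib))).symm
  have jensen : (μ.prod μ).real N ^ 2 ≤ ∫ x, m x ^ 2 ∂μ := by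
    have h := integral_nonneg (μ := μ) (f := fun x => (m x - (μ.prod μ).real N) ^ 2)
      fun x => sq_nonneg _
    have e : ∀ x, (m x - (μ.prod μ).real N) ^ 2
        = m x ^ 2 - 2 * (μ.prod μ).real N * m x + (μ.prod μ).real N ^ 2 := fun x => by ring
    simp only [e] at h
    rw [integral_add (f := fun x => m x ^ 2 - 2 * (μ.prod μ).real N * m x)
      (im2.sub (im.const_mul _)) (integrable_const _), integral_sub im2 (im.const_mul _),
      integral_const_mul, hM] at h
    simp only [integral_const, probReal_univ, smul_eq_mul, one_mul] at h
    nlinarith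
  have hmN : Integrable (fun w : X × X => N.indicator (fun w => m w.1) w) (μ.prod μ) :=
    (im.comp_fst μ).indicator hN
  have sq : ∫ w, N.indicator (fun w => m w.1) w ∂(μ.prod μ) = ∫ x, m x ^ 2 ∂μ := by
    rw [integral_prod _ hmN]
    refine integral_congr_ae (Eventually.of_forall fun x => ?_)
    have e : ∀ y, N.indicator (fun w => m w.1) (x, y)
        = m x * N.indicator (fun _ => (1 : ℝ)) (x, y) := fun y => by
      by_cases h : (x, y) ∈ N <;> simp [h]
    simp only [e]
    rw [integral_const_mul, fib, sq]
  have a1 : ∀ᵐ w ∂(μ.prod μ), Integrable (fun z => weighted η f g (w.1, z)) μ :=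
    Measure.quasiMeasurePreserving_fst.ae hG.prod_right_ae
  have a2 : ∀ᵐ w ∂(μ.prod μ), Integrable (fun z => weighted η f g (z, w.2)) μ :=
    Measure.quasiMeasurePreserving_snd.ae hG.prod_left_ae
  have ae : ∀ᵐ w ∂(μ.prod μ), c ^ 2 * g 0 * N.indicator (fun w => m w.1) w
      ≤ |variation μ η f g w.1| + |variation μ η f g w.2| := by
    filter_upwards [a1, a2] with w hw1 hw2
    by_cases h : w ∈ N
    · rw [Set.indicator_of_mem h]
      exact slope_mul_measure_misordered_le S hη h0 h1 hf hc h hw1 hw2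
    · rw [Set.indicator_of_notMem h, mul_zero]
      positivity
  have int := integral_mono_ae (hmN.const_mul (c ^ 2 * g 0))
    ((hv.comp_fst μ).add (hv.comp_snd μ)) ae
  rw [integral_const_mul, sq, integral_add' (hv.comp_fst μ) (hv.comp_snd μ),
    integral_fun_fst (μ := μ) (ν := μ) (fun x => |variation μ η f g x|),
    integral_fun_snd (μ := μ) (ν := μ) (fun x => |variation μ η f g x|)] at int
  simp only [probReal_univ, one_smul] at int
  have := mul_le_mul_of_nonneg_left jensen
    (mul_nonneg (sq_nonneg c) S.slope_zero_pos.le)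
  linarith

end

/-! ### The ranking risk and its excess. -/

section risk

variable (D : Measure (X × Bool)) [IsProbabilityMeasure D]

theorem measurable_eta : Measurable (eta D) :=
  (D.condKernel.measurable_coe (measurableSet_singleton true)).ennreal_toReal

theorem eta_nonneg (x : X) : 0 ≤ eta D x := measureReal_nonneg

theorem eta_le_one (x : X) : eta D x ≤ 1 := measureReal_le_one

theorem condKernel_real_false (x : X) : (D.condKernel x).real {false} = 1 - eta D x := by
  have h : ({false} : Set Bool) = {true}ᶜ := by ext b; cases b <;> simp
  rw [h, probReal_compl_eq_one_sub (measurableSet_singleton true), eta]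

theorem integral_eq_integral_fst {F : X × Bool → ℝ} (hF : Integrable F D) :
    ∫ z, F z ∂D = ∫ x, (eta D x * F (x, true) + (1 - eta D x) * F (x, false)) ∂D.fst := by
  have hD : D.fst ⊗ₘ D.condKernel = D := D.disintegrate D.condKernel
  rw [← hD] at hF
  calc ∫ z, F z ∂D = ∫ z, F z ∂(D.fst ⊗ₘ D.condKernel) := by rw [hD]
    _ = ∫ x, ∫ y, F (x, y) ∂(D.condKernel x) ∂D.fst := Measure.integral_compProd hF
    _ = _ := by
      refine integral_congr_ae (Eventually.of_forall fun x => ?_)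
      simp only
      rw [integral_fintype (Integrable.of_finite), Fintype.sum_bool, condKernel_real_false]
      rfl

theorem integral_prod_eq_integral_fst {F : (X × Bool) × (X × Bool) → ℝ} (hF : Measurable F)
    {C : ℝ} (hC : ∀ w, |F w| ≤ C) :
    ∫ w, F w ∂(D.prod D) = ∫ w, (eta D w.1 * (eta D w.2 * F ((w.1, true), (w.2, true))
        + (1 - eta D w.2) * F ((w.1, true), (w.2, false)))
      + (1 - eta D w.1) * (eta D w.2 * F ((w.1, false), (w.2, true))
        + (1 - eta D w.2) * F ((w.1, false), (w.2, false)))) ∂(D.fst.prod D.fst) := by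
  have hη := measurable_eta D
  have i1 : Integrable F (D.prod D) :=
    Integrable.of_bound hF.aestronglyMeasurable C (Eventually.of_forall hC)
  have hin : ∀ z, Integrable (fun z' => F (z, z')) D := fun z =>
    Integrable.of_bound (hF.comp measurable_prodMk_left).aestronglyMeasurable C
      (Eventually.of_forall fun z' => hC _)
  have ib : ∀ a b, Integrable (fun w : X × X => F ((w.1, a), (w.2, b))) (D.fst.prod D.fst) :=
    fun a b => Integrable.of_bound (hF.comp ((measurable_fst.prodMk measurable_const).prodMk
      (measurable_snd.prodMk measurable_const))).aestronglyMeasurable C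
      (Eventually.of_forall fun w => hC _)
  have bd : ∀ x, ‖eta D x‖ ≤ 1 := fun x => by
    rw [Real.norm_of_nonneg (eta_nonneg D x)]; exact eta_le_one D x
  have bd' : ∀ x, ‖1 - eta D x‖ ≤ 1 := fun x => by
    rw [Real.norm_of_nonneg (sub_nonneg.2 (eta_le_one D x))]; linarith [eta_nonneg D x]
  have ic : ∀ a, Integrable (fun w : X × X => eta D w.2 * F ((w.1, a), (w.2, true))
        + (1 - eta D w.2) * F ((w.1, a), (w.2, false))) (D.fst.prod D.fst) := fun a =>
    ((ib a true).bdd_mul (c := 1) (hη.comp measurable_snd).aestronglyMeasurable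
      (Eventually.of_forall fun w => bd _)).add
    ((ib a false).bdd_mul (c := 1) ((hη.comp measurable_snd).const_sub 1).aestronglyMeasurable
      (Eventually.of_forall fun w => bd' _))
  have id1 := (ic true).bdd_mul (c := 1) (hη.comp measurable_fst).aestronglyMeasurable
      (Eventually.of_forall fun w => bd w.1)
  have id2 := (ic false).bdd_mul (c := 1) ((hη.comp measurable_fst).const_sub 1).aestronglyMeasurable
      (Eventually.of_forall fun w => bd' w.1)
  have i2 := id1.add id2
  rw [integral_prod _ i1, integral_eq_integral_fst D i1.integral_prod_left]
  refine Eq.trans ?_ (integral_prod _ i2).symm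
  refine integral_congr_ae ?_
  filter_upwards [(ic true).prod_right_ae, (ic false).prod_right_ae] with x h1 h2
  simp only [Pi.add_apply, Function.comp_apply]
  rw [integral_eq_integral_fst D (hin _), integral_eq_integral_fst D (hin _),
    integral_add (h1.const_mul _) (h2.const_mul _), integral_const_mul, integral_const_mul]

/-- The cost of giving the score `a` to a positive and the score `b` to a negative instance. -/
noncomputable def pairLoss (a b : ℝ) : ℝ :=
  (if a < b then 1 else 0) + 1 / 2 * (if a = b then 1 else 0)

theorem pairLoss_nonneg (a b : ℝ) : 0 ≤ pairLoss a b := by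
  unfold pairLoss; split_ifs <;> norm_num

theorem pairLoss_add_swap (a b : ℝ) : pairLoss a b + pairLoss b a = 1 := by
  unfold pairLoss
  rcases lt_trichotomy a b with h | h | h
  · simp [h, h.not_gt, h.ne, h.ne']
  · subst h; norm_num
  · simp [h, h.not_gt, h.ne, h.ne']

theorem pairLoss_le_one (a b : ℝ) : pairLoss a b ≤ 1 := by
  linarith [pairLoss_add_swap a b, pairLoss_nonneg b a]

theorem pairLoss_of_lt {a b : ℝ} (h : b < a) : pairLoss a b = 0 := by
  simp [pairLoss, h.not_gt, h.ne']

/-- The conditional ranking loss of a pair of instances, with the label pair integrated out. -/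
noncomputable def pairRisk (η f : X → ℝ) (w : X × X) : ℝ :=
  η w.1 * (1 - η w.2) * pairLoss (f w.1) (f w.2) + η w.2 * (1 - η w.1) * pairLoss (f w.2) (f w.1)

theorem measurable_pairLoss {Y : Type*} [MeasurableSpace Y] {a b : Y → ℝ} (ha : Measurable a)
    (hb : Measurable b) : Measurable fun y => pairLoss (a y) (b y) :=
  (Measurable.ite (measurableSet_lt ha hb) measurable_const measurable_const).add
    ((Measurable.ite (measurableSet_eq_fun ha hb) measurable_const measurable_const).const_mul _)

omit [MeasurableSpace X] in
theorem rankingLoss_true_false (f : X → ℝ) (x x' : X) :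
    rankingLoss f (x, true) (x', false) = pairLoss (f x) (f x') := by
  have h : (labelVal true - labelVal false) * (f x - f x') < 0 ↔ f x < f x' := by
    simp only [labelVal, Bool.false_eq_true, if_false, if_true]
    constructor <;> intro h <;> linarith
  simp only [rankingLoss, pairLoss, h]

omit [MeasurableSpace X] in
theorem rankingLoss_false_true (f : X → ℝ) (x x' : X) :
    rankingLoss f (x, false) (x', true) = pairLoss (f x') (f x) := by
  have h : (labelVal false - labelVal true) * (f x - f x') < 0 ↔ f x' < f x := by
    simp only [labelVal, Bool.false_eq_true, if_false, if_true]
    constructor <;> intro h <;> linarith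
  simp only [rankingLoss, pairLoss, h, eq_comm (a := f x)]

theorem measurable_rankingLoss {f : X → ℝ} (hf : Measurable f) :
    Measurable fun w : (X × Bool) × (X × Bool) => rankingLoss f w.1 w.2 := by
  have hl : Measurable labelVal := measurable_of_finite _
  unfold rankingLoss
  refine Measurable.add (Measurable.ite (measurableSet_lt ?_ measurable_const) measurable_const
    measurable_const) (Measurable.const_mul (Measurable.ite (measurableSet_eq_fun ?_ ?_)
      measurable_const measurable_const) _) <;> fun_prop

/-- The normalizing constant need not be evaluated, since it is the same for all score functions. -/
theorem risk_eq {f : X → ℝ} (hf : Measurable f) :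
    risk D f = ((D.prod D).real {w | w.1.2 ≠ w.2.2})⁻¹
      * ∫ w, pairRisk (eta D) f w ∂(D.fst.prod D.fst) := by
  set E : Set ((X × Bool) × (X × Bool)) := {w | w.1.2 ≠ w.2.2} with hE
  have mE : MeasurableSet E :=
    (measurableSet_eq_fun (by fun_prop) (by fun_prop)).compl
  have mF := (measurable_rankingLoss hf).indicator mE
  have bF : ∀ w, |E.indicator (fun w => rankingLoss f w.1 w.2) w| ≤ 2 := by
    intro w
    by_cases h : w ∈ E
    · rw [Set.indicator_of_mem h, rankingLoss]
      split_ifs <;> norm_num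
    · rw [Set.indicator_of_notMem h]; norm_num
  rw [risk, ProbabilityTheory.cond, integral_smul_measure, ENNReal.toReal_inv, smul_eq_mul,
    ← integral_indicator mE, integral_prod_eq_integral_fst D mF bF]
  congr 1
  refine integral_congr_ae (Eventually.of_forall fun w => ?_)
  simp [hE, Set.indicator, rankingLoss_true_false, rankingLoss_false_true, pairRisk]
  ring

-- The two conditional risks differ by η(x) - η(x') times a difference of pair losses. If the gap is
-- at most c, so is this product; if it is larger and f orders the pair correctly, f is optimal
-- there; otherwise the pair or its swap is misordered and the product is at most 1.
omit [MeasurableSpace X] in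
theorem pairRisk_le {η : X → ℝ} (h0 : ∀ x, 0 ≤ η x) (h1 : ∀ x, η x ≤ 1) (f f' : X → ℝ) {c : ℝ}
    (hc : 0 ≤ c) (w : X × X) :
    pairRisk η f w ≤ pairRisk η f' w + (c + ((misordered η f c).indicator (fun _ => 1) w
      + (misordered η f c).indicator (fun _ => 1) w.swap)) := by
  have e : pairRisk η f w - pairRisk η f' w
      = (η w.1 - η w.2) * (pairLoss (f w.1) (f w.2) - pairLoss (f' w.1) (f' w.2)) := by
    unfold pairRisk
    rw [eq_sub_of_add_eq' (pairLoss_add_swap (f w.1) (f w.2)),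
      eq_sub_of_add_eq' (pairLoss_add_swap (f' w.1) (f' w.2))]
    ring
  have n1 : (0 : ℝ) ≤ (misordered η f c).indicator (fun _ => 1) w :=
    Set.indicator_nonneg (fun _ _ => zero_le_one) _
  have n2 : (0 : ℝ) ≤ (misordered η f c).indicator (fun _ => 1) w.swap :=
    Set.indicator_nonneg (fun _ _ => zero_le_one) _
  have a0 := pairLoss_nonneg (f w.1) (f w.2)
  have a1 := pairLoss_le_one (f w.1) (f w.2)
  have b0 := pairLoss_nonneg (f' w.1) (f' w.2)
  have b1 := pairLoss_le_one (f' w.1) (f' w.2)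
  suffices pairRisk η f w - pairRisk η f' w ≤ c + ((misordered η f c).indicator (fun _ => 1) w
      + (misordered η f c).indicator (fun _ => 1) w.swap) by linarith
  rw [e]
  rcases le_or_gt |η w.1 - η w.2| c with h | h
  · have hd : |pairLoss (f w.1) (f w.2) - pairLoss (f' w.1) (f' w.2)| ≤ 1 :=
      abs_le.2 ⟨by linarith, by linarith⟩
    have := mul_le_mul h hd (abs_nonneg _) hc
    rw [← abs_mul] at this
    linarith [le_of_abs_le this]
  rcases lt_abs.1 h with h | h
  · have hx : η w.1 - η w.2 ≤ 1 := by linarith [h1 w.1, h0 w.2]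
    rcases le_or_gt (f w.1) (f w.2) with hf | hf
    · have hm : w ∈ misordered η f c := ⟨by linarith, hf⟩
      rw [Set.indicator_of_mem hm]
      nlinarith
    · rw [pairLoss_of_lt hf]
      nlinarith
  · have hx : η w.2 - η w.1 ≤ 1 := by linarith [h1 w.2, h0 w.1]
    rcases le_or_gt (f w.2) (f w.1) with hf | hf
    · have hm : w.swap ∈ misordered η f c :=
        ⟨by simp only [Prod.fst_swap, Prod.snd_swap]; linarith, hf⟩
      rw [Set.indicator_of_mem hm]
      nlinarith
    · have := pairLoss_add_swap (f w.1) (f w.2)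
      rw [pairLoss_of_lt hf] at this
      nlinarith

theorem integrable_pairRisk {μ : Measure X} [IsProbabilityMeasure μ] {η f : X → ℝ}
    (hη : Measurable η) (h0 : ∀ x, 0 ≤ η x) (h1 : ∀ x, η x ≤ 1) (hf : Measurable f) :
    Integrable (pairRisk η f) (μ.prod μ) := by
  have m1 : Measurable (pairRisk η f) := by
    have := measurable_pairLoss (hf.comp measurable_fst) (hf.comp measurable_snd)
    have := measurable_pairLoss (hf.comp measurable_snd) (hf.comp measurable_fst)
    simp only [Function.comp_apply] at *
    unfold pairRisk
    fun_prop
  refine Integrable.of_bound m1.aestronglyMeasurable 2 (Eventually.of_forall fun w => ?_)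
  have p := weight_nonneg h0 h1 w.1 w.2
  have p' := weight_nonneg h0 h1 w.2 w.1
  have l := pairLoss_nonneg (f w.1) (f w.2)
  have l' := pairLoss_nonneg (f w.2) (f w.1)
  rw [pairRisk, Real.norm_of_nonneg (add_nonneg (mul_nonneg p l) (mul_nonneg p' l'))]
  have := mul_le_one₀ (weight_le_one h0 h1 w.1 w.2) l (pairLoss_le_one _ _)
  have := mul_le_one₀ (weight_le_one h0 h1 w.2 w.1) l' (pairLoss_le_one _ _)
  linarith

theorem risk_le_add {f f' : X → ℝ} (hf : Measurable f) (hf' : Measurable f') {c : ℝ}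
    (hc : 0 ≤ c) :
    risk D f ≤ risk D f' + ((D.prod D).real {w | w.1.2 ≠ w.2.2})⁻¹
      * (c + 2 * (D.fst.prod D.fst).real (misordered (eta D) f c)) := by
  have hη := measurable_eta D
  have hN := measurableSet_misordered hη hf c
  have i1 : Integrable ((misordered (eta D) f c).indicator fun _ => (1 : ℝ))
      (D.fst.prod D.fst) := (integrable_const _).indicator hN
  have key := integral_mono (integrable_pairRisk (μ := D.fst) hη (eta_nonneg D) (eta_le_one D) hf)
    ((integrable_pairRisk hη (eta_nonneg D) (eta_le_one D) hf').add
      ((integrable_const c).add (i1.add i1.swap)))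
    (pairRisk_le (eta_nonneg D) (eta_le_one D) f f' hc)
  rw [integral_add' (integrable_pairRisk hη (eta_nonneg D) (eta_le_one D) hf')
    ((integrable_const c).add (i1.add i1.swap)),
    integral_add' (integrable_const c) (i1.add i1.swap), integral_add' i1 i1.swap] at key
  have sw := integral_prod_swap (μ := D.fst) (ν := D.fst)
    ((misordered (eta D) f c).indicator fun _ => (1 : ℝ))
  have v : ∫ w, (misordered (eta D) f c).indicator (fun _ => (1 : ℝ)) w ∂(D.fst.prod D.fst)
      = (D.fst.prod D.fst).real (misordered (eta D) f c) := integral_indicator_one hN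
  simp only [Function.comp_apply] at key
  rw [sw, v, integral_const, probReal_univ, one_smul] at key
  rw [risk_eq D hf, risk_eq D hf', ← mul_add]
  refine mul_le_mul_of_nonneg_left ?_ (inv_nonneg.2 measureReal_nonneg)
  linarith

omit [IsProbabilityMeasure D] in
theorem risk_nonneg (f : X → ℝ) : 0 ≤ risk D f := by
  refine integral_nonneg fun w => ?_
  unfold rankingLoss
  positivity

end risk

/-! ### The five losses as surrogates. -/

theorem modulus_of_lipschitz {φ g : ℝ → ℝ} (hφ : ∀ t, 0 ≤ φ t) {K : ℝ} (hK : 0 < K)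
    (h : ∀ s t, |g s - g t| ≤ K * |s - t|) :
    ∀ δ > 0, ∃ τ > 0, ∀ t u, |u| ≤ τ → |g (t + u) - g t| ≤ δ * (1 + φ t) := by
  intro δ hδ
  refine ⟨δ / K, by positivity, fun t u hu => (h _ _).trans ?_⟩
  rw [add_sub_cancel_left]
  have h1 : K * |u| ≤ δ := by
    rw [le_div_iff₀ hK] at hu; linarith
  nlinarith [hφ t]

theorem exists_abs_exp_sub_one_le {δ : ℝ} (hδ : 0 < δ) :
    ∃ τ > 0, ∀ u : ℝ, |u| ≤ τ → |Real.exp u - 1| ≤ δ := by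
  obtain ⟨τ, hτ, H⟩ := Metric.continuousAt_iff.1 (Real.continuous_exp.continuousAt (x := 0)) δ hδ
  refine ⟨τ / 2, half_pos hτ, fun u hu => ?_⟩
  have := H (x := u) (by rw [Real.dist_eq, sub_zero]; linarith)
  rw [Real.dist_eq, Real.exp_zero] at this
  exact this.le

theorem isSurrogate_exp : IsSurrogate expLoss fun t => Real.exp (-t) where
  nonneg t := (Real.exp_pos _).le
  slope_nonneg t := (Real.exp_pos _).le
  slope_zero_pos := Real.exp_pos _
  subgradient a b := by
    have h1 := Real.add_one_le_exp (a - b)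
    have h2 : expLoss b = Real.exp (-a) * Real.exp (a - b) := by
      rw [expLoss, ← Real.exp_add]; ring_nf
    have h3 := mul_le_mul_of_nonneg_left h1 (Real.exp_pos (-a)).le
    rw [h2]; simp only [expLoss]; linarith
  modulus δ hδ := by
    obtain ⟨τ, hτ, H⟩ := exists_abs_exp_sub_one_le hδ
    refine ⟨τ, hτ, fun t u hu => ?_⟩
    have h1 := H (-u) (by rwa [abs_neg])
    have h2 : Real.exp (-(t + u)) - Real.exp (-t)
        = Real.exp (-t) * (Real.exp (-u) - 1) := by
      rw [mul_sub, ← Real.exp_add]; ring_nf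
    rw [h2, abs_mul, abs_of_pos (Real.exp_pos _), expLoss]
    nlinarith [Real.exp_pos (-t)]

theorem isSurrogate_logistic : IsSurrogate logisticLoss fun t => 1 / (1 + Real.exp t) where
  nonneg t := Real.log_nonneg (by linarith [Real.exp_pos (-t)])
  slope_nonneg t := by positivity
  slope_zero_pos := by positivity
  subgradient a b := by
    have ha := Real.exp_pos a
    have hp : 0 < 1 + Real.exp (-a) := by positivity
    have hq : 0 < 1 + Real.exp (-b) := by positivity
    -- Weighted AM-GM for 1 and exp(a - b), with weight 1/(1 + exp a) equal to the slope at a; its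
    -- logarithm is the tangent inequality.
    have h := convexOn_exp.right (Set.mem_univ (0 : ℝ)) (Set.mem_univ (a - b))
      (by positivity : 0 ≤ Real.exp a / (1 + Real.exp a))
      (by positivity : 0 ≤ 1 / (1 + Real.exp a)) (by field_simp; ring)
    simp only [smul_eq_mul, mul_zero, zero_add, Real.exp_zero, mul_one] at h
    have e : Real.exp a / (1 + Real.exp a) + 1 / (1 + Real.exp a) * Real.exp (a - b)
        = (1 + Real.exp (-b)) / (1 + Real.exp (-a)) := by
      rw [sub_eq_add_neg, Real.exp_add, Real.exp_neg a]
      field_simp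
      ring
    rw [e] at h
    have h2 := Real.log_le_log (Real.exp_pos _) h
    rw [Real.log_exp, Real.log_div hq.ne' hp.ne'] at h2
    simp only [logisticLoss]
    linarith
  modulus δ hδ := by
    obtain ⟨τ, hτ, H⟩ := exists_abs_exp_sub_one_le hδ
    refine ⟨τ, hτ, fun t u hu => ?_⟩
    have h1 := H u hu
    have ht := Real.exp_pos t
    have htu := Real.exp_pos u
    have hl : 0 ≤ logisticLoss t := Real.log_nonneg (by linarith [Real.exp_pos (-t)])
    have e : 1 / (1 + Real.exp (t + u)) - 1 / (1 + Real.exp t)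
        = -(Real.exp t / ((1 + Real.exp t * Real.exp u) * (1 + Real.exp t)))
            * (Real.exp u - 1) := by
      rw [Real.exp_add]; field_simp; ring
    have hle : Real.exp t / ((1 + Real.exp t * Real.exp u) * (1 + Real.exp t)) ≤ 1 := by
      rw [div_le_one (by positivity)]
      nlinarith [mul_pos ht htu, mul_pos (mul_pos ht htu) ht]
    rw [e, abs_mul, abs_neg, abs_of_nonneg (by positivity)]
    have := mul_le_mul hle h1 (abs_nonneg _) zero_le_one
    nlinarith

theorem isSurrogate_distWeighted {ε : ℝ} (hε : 0 < ε) :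
    IsSurrogate (distWeightedLoss ε) fun t => 1 / max ε t ^ 2 := by
  -- A single formula in max(ε, t) avoids splitting into cases at ε.
  have form : ∀ t, distWeightedLoss ε t = 1 / max ε t + (max ε t - t) / ε ^ 2 := by
    intro t
    unfold distWeightedLoss
    split_ifs with h
    · rw [max_eq_right h]; simp
    · rw [max_eq_left (not_le.1 h).le]; field_simp; ring
  have pos : ∀ t, 0 < max ε t := fun t => lt_max_of_lt_left hε
  have nn : ∀ t, 0 ≤ distWeightedLoss ε t := fun t => by
    rw [form]
    have := pos t
    have : 0 ≤ max ε t - t := sub_nonneg.2 (le_max_right _ _)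
    positivity
  refine ⟨nn, fun t => by positivity, by have := pos 0; positivity, fun a b => ?_,
    modulus_of_lipschitz (g := fun t => 1 / max ε t ^ 2) nn (K := 2 / ε ^ 3)
      (by positivity) fun s t => ?_⟩
  · rw [form, form]
    have hm := pos a
    have hn := pos b
    have hma := le_max_left ε a
    have hnb := le_max_right ε b
    have tangent : 1 / max ε a - (max ε b - max ε a) / max ε a ^ 2 ≤ 1 / max ε b := by
      have : 1 / max ε b - (1 / max ε a - (max ε b - max ε a) / max ε a ^ 2)
          = (max ε b - max ε a) ^ 2 / (max ε a ^ 2 * max ε b) := by field_simp; ring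
      have h : 0 ≤ (max ε b - max ε a) ^ 2 / (max ε a ^ 2 * max ε b) := by positivity
      linarith
    have slope : 1 / max ε a ^ 2 ≤ 1 / ε ^ 2 := by gcongr
    have h3 := mul_le_mul_of_nonneg_right slope (sub_nonneg.2 hnb)
    have h4 : (max ε a - a) / ε ^ 2 = (max ε a - a) * (1 / max ε a ^ 2) := by
      rcases le_total ε a with h | h
      · simp [max_eq_right h]
      · rw [max_eq_left h]; ring
    rw [h4]
    have e1 : (max ε b - max ε a) / max ε a ^ 2
        = 1 / max ε a ^ 2 * (max ε b - max ε a) := by ring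
    have e2 : (max ε b - b) / ε ^ 2 = 1 / ε ^ 2 * (max ε b - b) := by ring
    rw [e1] at tangent
    rw [e2]
    linarith
  · have hs := pos s
    have ht := pos t
    have hsε := le_max_left ε s
    have htε := le_max_left ε t
    have hd : |max ε s - max ε t| ≤ |s - t| := by
      have := abs_max_sub_max_le_abs s t ε
      rwa [max_comm s, max_comm t] at this
    have e : 1 / max ε s ^ 2 - 1 / max ε t ^ 2
        = -(1 / max ε s / max ε t ^ 2 + 1 / max ε s ^ 2 / max ε t) * (max ε s - max ε t) := by
      field_simp; ring
    have b1 : 1 / max ε s / max ε t ^ 2 ≤ 1 / ε / ε ^ 2 := by gcongr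
    have b2 : 1 / max ε s ^ 2 / max ε t ≤ 1 / ε ^ 2 / ε := by gcongr
    have b3 : 1 / ε / ε ^ 2 + 1 / ε ^ 2 / ε = 2 / ε ^ 3 := by field_simp; norm_num
    rw [e, abs_mul, abs_neg, abs_of_nonneg (by positivity)]
    exact mul_le_mul (by linarith) hd (abs_nonneg _) (by positivity)

theorem isSurrogate_generalHinge {ε : ℝ} (hε : 0 < ε) :
    IsSurrogate (generalHingeLoss ε) fun t => max 0 (min 1 ((1 + ε - t) / (2 * ε))) := by
  have nn : ∀ t, 0 ≤ generalHingeLoss ε t := by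
    intro t; unfold generalHingeLoss; split_ifs
    · linarith
    · positivity
    · rfl
  -- The loss is the maximum over s in [0, 1] of the affine functions s(1 + ε - t) - ε s², attained
  -- at s equal to the slope; the subgradient inequality follows at once.
  have conj_le : ∀ t s, 0 ≤ s → s ≤ 1 → s * (1 + ε - t) - ε * s ^ 2 ≤ generalHingeLoss ε t := by
    intro t s h0 h1
    unfold generalHingeLoss
    split_ifs with h h'
    · nlinarith [mul_nonneg (sub_nonneg.2 h1) (sub_nonneg.2 h),
        mul_nonneg hε.le (mul_nonneg (sub_nonneg.2 h1) (sub_nonneg.2 h1))]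
    · rw [le_div_iff₀ (by positivity)]
      nlinarith [sq_nonneg (2 * ε * s - (1 + ε - t))]
    · nlinarith [mul_nonneg h0 (sub_nonneg.2 (not_lt.1 h')), mul_nonneg hε.le (sq_nonneg s)]
  have conj_eq : ∀ t, max 0 (min 1 ((1 + ε - t) / (2 * ε))) * (1 + ε - t)
      - ε * max 0 (min 1 ((1 + ε - t) / (2 * ε))) ^ 2 = generalHingeLoss ε t := by
    intro t
    unfold generalHingeLoss
    split_ifs with h h'
    · rw [min_eq_left (by rw [le_div_iff₀ (by positivity)]; linarith), max_eq_right zero_le_one]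
      ring
    · rw [min_eq_right (by rw [div_le_iff₀ (by positivity)]; linarith [not_le.1 h]),
        max_eq_right (div_nonneg (by linarith) (by positivity))]
      field_simp; ring
    · rw [min_eq_right (by rw [div_le_iff₀ (by positivity)]; linarith [not_le.1 h]),
        max_eq_left (div_nonpos_of_nonpos_of_nonneg (by linarith [not_lt.1 h']) (by positivity))]
      simp
  refine ⟨nn, fun t => le_max_left _ _,
    lt_max_of_lt_right (lt_min one_pos (by rw [sub_zero]; positivity)),
    fun a b => ?_, modulus_of_lipschitz
      (g := fun t => max 0 (min 1 ((1 + ε - t) / (2 * ε)))) nn (K := 1 / (2 * ε))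
      (by positivity) fun s t => ?_⟩
  · have h := conj_le b (max 0 (min 1 ((1 + ε - a) / (2 * ε)))) (le_max_left _ _)
      (max_le zero_le_one (min_le_left _ _))
    rw [← conj_eq a]
    linarith
  · refine (abs_max_sub_max_le_max _ _ _ _).trans (max_le (by simp; positivity) ?_)
    refine (abs_min_sub_min_le_max _ _ _ _).trans (max_le (by simp; positivity) ?_)
    rw [← sub_div, abs_div, abs_of_pos (by positivity : 0 < 2 * ε), div_eq_mul_one_div,
      mul_comm (1 / (2 * ε)), abs_sub_comm s t]
    ring_nf
    rfl

/-- Bernoulli's inequality at y/x, scaled by x^q. -/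
theorem rpow_tangent_le {q x y : ℝ} (hq : 1 < q) (hx : 0 < x) (hy : 0 ≤ y) :
    x ^ q + q * x ^ (q - 1) * (y - x) ≤ y ^ q := by
  have h := one_add_mul_self_le_rpow_one_add (s := y / x - 1) (p := q)
    (by have : 0 ≤ y / x := by positivity
        linarith) hq.le
  rw [add_sub_cancel, Real.div_rpow hy hx.le, le_div_iff₀ (Real.rpow_pos_of_pos hx q)] at h
  have e : x ^ q = x ^ (q - 1) * x := by
    rw [← Real.rpow_add_one hx.ne']; ring_nf
  have e2 : (1 + q * (y / x - 1)) * x ^ q = x ^ q + q * x ^ (q - 1) * (y - x) := by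
    rw [e]; field_simp
  linarith

/-- Uniform continuity on a compact interval handles bounded a; for a ≥ 1, homogeneity reduces the
bound to the point 1 with increment u/a. -/
theorem exists_abs_max_rpow_sub_le {r δ : ℝ} (hr : 0 < r) (hδ : 0 < δ) :
    ∃ τ > 0, ∀ a u : ℝ, |u| ≤ τ →
      |(max 0 (a + u)) ^ r - (max 0 a) ^ r| ≤ δ * (1 + (max 0 a) ^ r) := by
  have cont : Continuous fun a : ℝ => (max 0 a) ^ r :=
    (continuous_const.max continuous_id).rpow_const fun _ => Or.inr hr.le
  obtain ⟨τ₁, hτ₁, H₁⟩ := Metric.uniformContinuousOn_iff.1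
    ((isCompact_Icc (a := (-3 : ℝ)) (b := 3)).uniformContinuousOn_of_continuous
      cont.continuousOn) δ hδ
  refine ⟨min (τ₁ / 2) 1, by positivity, fun a u hu => ?_⟩
  have near : ∀ b v : ℝ, -2 ≤ b → b ≤ 2 → |v| ≤ min (τ₁ / 2) 1 →
      |(max 0 (b + v)) ^ r - (max 0 b) ^ r| ≤ δ := by
    intro b v hb1 hb2 hv
    have hv1 := abs_le.1 (hv.trans (min_le_right _ _))
    have hv2 := hv.trans (min_le_left _ _)
    have := H₁ (b + v) ⟨by linarith, by linarith⟩ b ⟨by linarith, by linarith⟩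
      (by rw [Real.dist_eq, add_sub_cancel_left]; linarith)
    exact this.le
  have hp : 0 ≤ (max 0 a) ^ r := Real.rpow_nonneg (le_max_left _ _) _
  have hu1 := abs_le.1 (hu.trans (min_le_right _ _))
  rcases le_total a 1 with ha | ha
  · rcases le_total (-2) a with hb | hb
    · nlinarith [near a u hb (by linarith) hu]
    · rw [max_eq_left (by linarith), max_eq_left (by linarith), sub_self, abs_zero]
      positivity
  · have hsc : |u / a| ≤ min (τ₁ / 2) 1 := by
      rw [abs_div, abs_of_pos (by linarith : 0 < a)]
      exact (div_le_self (abs_nonneg u) ha).trans hu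
    have h := near 1 (u / a) (by norm_num) (by norm_num) hsc
    have ha0 : 0 < a := by linarith
    have h1 : (0 : ℝ) ≤ 1 + u / a := by
      have := (abs_le.1 (hsc.trans (min_le_right _ _))).1
      linarith
    have e : a + u = a * (1 + u / a) := by field_simp
    rw [max_eq_right h1, max_eq_right zero_le_one, Real.one_rpow] at h
    rw [max_eq_right (by linarith : 0 ≤ a + u), max_eq_right ha0.le, e,
      Real.mul_rpow ha0.le h1]
    have e2 : a ^ r * (1 + u / a) ^ r - a ^ r = a ^ r * ((1 + u / a) ^ r - 1) := by ring
    have har : 0 ≤ a ^ r := Real.rpow_nonneg ha0.le _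
    rw [e2, abs_mul, abs_of_nonneg har]
    nlinarith

theorem isSurrogate_qHinge {q : ℝ} (hq : 1 < q) :
    IsSurrogate (qHingeLoss q) fun t => q * (max 0 (1 - t)) ^ (q - 1) where
  nonneg t := Real.rpow_nonneg (le_max_left _ _) _
  slope_nonneg t := mul_nonneg (by linarith) (Real.rpow_nonneg (le_max_left _ _) _)
  slope_zero_pos := by simp; linarith
  subgradient a b := by
    unfold qHingeLoss
    rcases le_or_gt (1 - a) 0 with h | h
    · rw [max_eq_left h, Real.zero_rpow (by linarith), Real.zero_rpow (by linarith)]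
      have := Real.rpow_nonneg (le_max_left 0 (1 - b)) q
      linarith
    · rw [max_eq_right h.le]
      have h1 := rpow_tangent_le hq h (le_max_left 0 (1 - b))
      have h2 : 0 ≤ q * (1 - a) ^ (q - 1) :=
        mul_nonneg (by linarith) (Real.rpow_nonneg h.le _)
      nlinarith [mul_le_mul_of_nonneg_left (le_max_right 0 (1 - b)) h2]
  modulus δ hδ := by
    have hq0 : 0 < q := by linarith
    obtain ⟨τ, hτ, H⟩ := exists_abs_max_rpow_sub_le (r := q - 1) (by linarith)
      -- The q cancels the factor in the slope; the 2 absorbs 1 + x^(q-1) ≤ 2 + x^q ≤ 2(1 + x^q).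
      (by positivity : 0 < δ / (2 * q))
    refine ⟨τ, hτ, fun t u hu => ?_⟩
    have h := H (1 - t) (-u) (by rwa [abs_neg])
    have e : 1 - (t + u) = 1 - t + -u := by ring
    have hm := le_max_left 0 (1 - t)
    have hle : (max 0 (1 - t)) ^ (q - 1) ≤ 1 + (max 0 (1 - t)) ^ q := by
      rcases le_total (max 0 (1 - t)) 1 with h1 | h1
      · have := Real.rpow_le_one hm h1 (by linarith : 0 ≤ q - 1)
        have := Real.rpow_nonneg hm q
        linarith
      · have := Real.rpow_le_rpow_of_exponent_le h1 (by linarith : q - 1 ≤ q)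
        linarith
    have hn := Real.rpow_nonneg hm q
    simp only [qHingeLoss]
    rw [e, ← mul_sub, abs_mul, abs_of_pos hq0]
    calc _ ≤ q * (δ / (2 * q) * (1 + (max 0 (1 - t)) ^ (q - 1))) := by gcongr
      _ = δ * ((1 + (max 0 (1 - t)) ^ (q - 1)) / 2) := by field_simp
      _ ≤ _ := by
        apply mul_le_mul_of_nonneg_left _ hδ.le
        linarith

/-! ### Passage to the limit and consistency. -/

section

variable {μ : Measure X} [IsProbabilityMeasure μ] {η f : X → ℝ} {φ g : ℝ → ℝ}

theorem lintegral_weighted_add_swap (h0 : ∀ x, 0 ≤ η x) (h1 : ∀ x, η x ≤ 1)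
    (hφ : ∀ t, 0 ≤ φ t) (hW : Integrable (weighted η f φ) (μ.prod μ)) :
    ∫⁻ w, ENNReal.ofReal (weighted η f φ w + weighted η f φ w.swap) ∂(μ.prod μ)
      = ENNReal.ofReal (2 * ∫ w, weighted η f φ w ∂(μ.prod μ)) := by
  have e := integral_prod_swap (μ := μ) (ν := μ) (weighted η f φ)
  rw [← ofReal_integral_eq_lintegral_ofReal
    (f := fun w => weighted η f φ w + weighted η f φ w.swap) (hW.add hW.swap) (Eventually.of_forall fun w =>
    add_nonneg (weighted_nonneg h0 h1 hφ w) (weighted_nonneg h0 h1 hφ w.swap)),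
    integral_add (g := fun w : X × X => weighted η f φ w.swap) hW hW.swap, e, two_mul]

omit [IsProbabilityMeasure μ] in
theorem integrable_weighted_of_lintegral_lt_top (S : IsSurrogate φ g) (hη : Measurable η)
    (h0 : ∀ x, 0 ≤ η x) (h1 : ∀ x, η x ≤ 1) (hf : Measurable f)
    (h : ∫⁻ w, ENNReal.ofReal (weighted η f φ w + weighted η f φ w.swap) ∂(μ.prod μ) < ⊤) :
    Integrable (weighted η f φ) (μ.prod μ) := by
  refine ⟨(measurable_weighted hη hf S.loss_antitone.measurable).aestronglyMeasurable, ?_⟩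
  rw [hasFiniteIntegral_iff_ofReal
    (Eventually.of_forall fun w => weighted_nonneg h0 h1 S.nonneg w)]
  refine lt_of_le_of_lt (lintegral_mono fun w => ENNReal.ofReal_le_ofReal ?_) h
  exact le_add_of_nonneg_right (weighted_nonneg h0 h1 S.nonneg _)

theorem tendsto_integral_abs_variation (S : IsSurrogate φ g) (hη : Measurable η)
    (h0 : ∀ x, 0 ≤ η x) (h1 : ∀ x, η x ≤ 1) {f : ℕ → X → ℝ} (hf : ∀ n, Measurable (f n)) {J : ℝ}
    (hJ0 : 0 ≤ J) (hW : ∀ᶠ n in atTop, Integrable (weighted η (f n) φ) (μ.prod μ))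
    (hJ : ∀ f', Measurable f' → Integrable (weighted η f' φ) (μ.prod μ) →
      J ≤ ∫ w, weighted η f' φ w ∂(μ.prod μ))
    (hlim : Tendsto (fun n => ∫ w, weighted η (f n) φ w ∂(μ.prod μ)) atTop (𝓝 J)) :
    Tendsto (fun n => ∫ x, |variation μ η (f n) g x| ∂μ) atTop (𝓝 0) := by
  refine tendsto_order.2 ⟨fun a ha => Eventually.of_forall fun n =>
    ha.trans_le (integral_nonneg fun x => abs_nonneg _), fun a ha => ?_⟩
  obtain ⟨τ, hτ, H⟩ := integral_abs_variation_le (μ := μ) S hη h0 h1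
    -- With this δ the error term tends to a/2, while the excess term tends to 0.
    (by positivity : 0 < a / (2 * (1 + J)))
  have hl := ((hlim.sub_const J).div_const τ).add ((hlim.const_add 1).const_mul
    (a / (2 * (1 + J))))
  have e : (J - J) / τ + a / (2 * (1 + J)) * (1 + J) < a := by
    have : a / (2 * (1 + J)) * (1 + J) = a / 2 := by field_simp
    rw [this, sub_self, zero_div]; linarith
  filter_upwards [hW, hl.eventually_lt_const e] with n hn hn'
  exact (H (f n) J (hf n) hn hJ).trans_lt hn'

theorem tendsto_measure_misordered (S : IsSurrogate φ g) (hη : Measurable η)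
    (h0 : ∀ x, 0 ≤ η x) (h1 : ∀ x, η x ≤ 1) {f : ℕ → X → ℝ} (hf : ∀ n, Measurable (f n))
    (hW : ∀ᶠ n in atTop, Integrable (weighted η (f n) φ) (μ.prod μ))
    (hv : Tendsto (fun n => ∫ x, |variation μ η (f n) g x| ∂μ) atTop (𝓝 0)) {c : ℝ}
    (hc : 0 < c) :
    Tendsto (fun n => (μ.prod μ).real (misordered η (f n) c)) atTop (𝓝 0) := by
  have hk : 0 < c ^ 2 * g 0 := mul_pos (by positivity) S.slope_zero_pos
  have hl := ((hv.const_mul 2).div_const (c ^ 2 * g 0)).sqrt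
  rw [mul_zero, zero_div, Real.sqrt_zero] at hl
  refine squeeze_zero' (Eventually.of_forall fun n => measureReal_nonneg) ?_ hl
  filter_upwards [hW] with n hn
  refine Real.le_sqrt_of_sq_le ?_
  rw [le_div_iff₀ hk, mul_comm]
  exact sq_measure_misordered_le S hη h0 h1 (hf n) hn hc

end

theorem phiRisk_eq (φ : ℝ → ℝ) (D : Measure (X × Bool)) [IsProbabilityMeasure D] (f : X → ℝ) :
    phiRisk φ D f = (ENNReal.ofReal (2 * posProb D * (1 - posProb D)))⁻¹ *
      ∫⁻ w, ENNReal.ofReal (weighted (eta D) f φ w + weighted (eta D) f φ w.swap)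
        ∂(D.fst.prod D.fst) := rfl

theorem IsSurrogate.consistent {φ g : ℝ → ℝ} (S : IsSurrogate φ g) : Consistent X φ := by
  intro f hf D _ hp hp' hlim
  have hη := measurable_eta D
  have h0 := eta_nonneg D
  have h1 := eta_le_one D
  set C := (ENNReal.ofReal (2 * posProb D * (1 - posProb D)))⁻¹ with hC
  have hC0 : C ≠ 0 := ENNReal.inv_ne_zero.2 ENNReal.ofReal_ne_top
  have hCt : C ≠ ⊤ := ENNReal.inv_ne_top.2 (ENNReal.ofReal_pos.2
    (mul_pos (by linarith) (by linarith))).ne'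
  have toInt : ∀ f', Measurable f' → phiRisk φ D f' < ⊤ →
      Integrable (weighted (eta D) f' φ) (D.fst.prod D.fst) := fun f' hf' h =>
    integrable_weighted_of_lintegral_lt_top S hη h0 h1 hf'
      (ENNReal.lt_top_of_mul_ne_top_right h.ne hC0)
  have ofInt : ∀ f', Integrable (weighted (eta D) f' φ) (D.fst.prod D.fst) →
      phiRisk φ D f' = C * ENNReal.ofReal (2 * ∫ w, weighted (eta D) f' φ w ∂(D.fst.prod D.fst)) :=
    fun f' h => by rw [phiRisk_eq, lintegral_weighted_add_swap h0 h1 S.nonneg h]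
  have opt_le : ∀ f', Measurable f' → optPhiRisk φ D ≤ phiRisk φ D f' := fun f' hf' =>
    iInf_le (fun f : {f : X → ℝ // Measurable f} => phiRisk φ D f.1) ⟨f', hf'⟩
  have hfin : optPhiRisk φ D < ⊤ := by
    -- The constant score has finite surrogate risk, so the optimum is finite and the risks are
    -- eventually finite too.
    refine (opt_le (fun _ => 0) measurable_const).trans_lt ?_
    rw [ofInt]
    · exact ENNReal.mul_lt_top hCt.lt_top ENNReal.ofReal_lt_top
    · refine Integrable.of_bound (measurable_weighted hη measurable_const
        S.loss_antitone.measurable).aestronglyMeasurable (φ 0) (Eventually.of_forall fun w => ?_)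
      rw [Real.norm_of_nonneg (weighted_nonneg h0 h1 S.nonneg w), weighted, sub_self]
      exact mul_le_of_le_one_left (S.nonneg 0) (weight_le_one h0 h1 _ _)
  have hk : 0 < C.toReal * 2 := mul_pos (ENNReal.toReal_pos hC0 hCt) two_pos
  have toReal_eq : ∀ f', Integrable (weighted (eta D) f' φ) (D.fst.prod D.fst) →
      (phiRisk φ D f').toReal / (C.toReal * 2)
        = ∫ w, weighted (eta D) f' φ w ∂(D.fst.prod D.fst) := fun f' h => by
    rw [ofInt f' h, ENNReal.toReal_mul, ENNReal.toReal_ofReal (mul_nonneg zero_le_two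
      (integral_nonneg fun w => weighted_nonneg h0 h1 S.nonneg w)), ← mul_assoc,
      mul_div_cancel_left₀ _ hk.ne']
  have hW : ∀ᶠ n in atTop, Integrable (weighted (eta D) (f n) φ) (D.fst.prod D.fst) := by
    filter_upwards [hlim.eventually_lt_const hfin] with n hn
    exact toInt _ (hf n) hn
  have hJ : ∀ f', Measurable f' → Integrable (weighted (eta D) f' φ) (D.fst.prod D.fst) →
      (optPhiRisk φ D).toReal / (C.toReal * 2)
        ≤ ∫ w, weighted (eta D) f' φ w ∂(D.fst.prod D.fst) := fun f' hf' h => by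
    rw [← toReal_eq f' h]
    refine div_le_div_of_nonneg_right (ENNReal.toReal_mono ?_ (opt_le f' hf')) hk.le
    rw [ofInt f' h]
    exact ENNReal.mul_ne_top hCt ENNReal.ofReal_ne_top
  have hlimJ : Tendsto (fun n => ∫ w, weighted (eta D) (f n) φ w ∂(D.fst.prod D.fst)) atTop
      (𝓝 ((optPhiRisk φ D).toReal / (C.toReal * 2))) := by
    refine (((ENNReal.tendsto_toReal hfin.ne).comp hlim).div_const _).congr' ?_
    filter_upwards [hW] with n hn
    exact toReal_eq _ hn
  have hv := tendsto_integral_abs_variation S hη h0 h1 hf (by positivity) hW hJ hlimJ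
  have bdd : BddBelow (Set.range fun f : {f : X → ℝ // Measurable f} => risk D f.1) :=
    ⟨0, by rintro _ ⟨f, rfl⟩; exact risk_nonneg D f.1⟩
  have : Nonempty {f : X → ℝ // Measurable f} := ⟨⟨fun _ => 0, measurable_const⟩⟩
  refine tendsto_order.2 ⟨fun a ha => Eventually.of_forall fun n =>
    ha.trans_le (ciInf_le bdd ⟨f n, hf n⟩), fun a ha => ?_⟩
  -- A competitor with risk below a replaces a Bayes-optimal ranker.
  obtain ⟨⟨f', hf'⟩, hlt⟩ := exists_lt_of_ciInf_lt ha
  simp only at hlt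
  set K := ((D.prod D).real {w | w.1.2 ≠ w.2.2})⁻¹
  have hK : 0 ≤ K := inv_nonneg.2 measureReal_nonneg
  have hr : 0 < a - risk D f' := sub_pos.2 hlt
  -- This gap c satisfies K c < a - R(f'), leaving room for the vanishing misordering term.
  have hc : 0 < (a - risk D f') / (K + 1) := by positivity
  have hm := ((((tendsto_measure_misordered S hη h0 h1 hf hW hv hc).const_mul 2).const_add
    ((a - risk D f') / (K + 1))).const_mul K).const_add (risk D f')
  have e : risk D f' + K * ((a - risk D f') / (K + 1) + 2 * 0) < a := by
    have : K * ((a - risk D f') / (K + 1)) = (a - risk D f') - (a - risk D f') / (K + 1) := by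
      field_simp; ring
    rw [mul_zero, add_zero, this]
    linarith
  filter_upwards [hm.eventually_lt_const e] with n hn
  exact (risk_le_add D (hf n) hf' hc.le).trans_lt hn

end AUC

theorem mainTheorem3 {X : Type*} [MeasurableSpace X] :
    AUC.Consistent X AUC.expLoss ∧
    AUC.Consistent X AUC.logisticLoss ∧
    (∀ ε : ℝ, 0 < ε → AUC.Consistent X (AUC.distWeightedLoss ε)) ∧
    (∀ q : ℝ, 1 < q → AUC.Consistent X (AUC.qHingeLoss q)) ∧
    (∀ ε : ℝ, 0 < ε → AUC.Consistent X (AUC.generalHingeLoss ε)) :=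
  ⟨AUC.isSurrogate_exp.consistent, AUC.isSurrogate_logistic.consistent,
    fun _ hε => (AUC.isSurrogate_distWeighted hε).consistent,
    fun _ hq => (AUC.isSurrogate_qHinge hq).consistent,
    fun _ hε => (AUC.isSurrogate_generalHinge hε).consistent⟩
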